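/- Let $\mathcal{Y}=\{0,1\}$. A learning problem $(\mathcal{H},\mathcal{P})$ on a measurable space $\mathcal{X}$ consists of a set $\mathcal{H}$ of measurable classifiers $h:\mathcal{X}\to\mathcal{Y}$ and a set $\mathcal{P}$ of probability distributions on $\mathcal{X}\times\mathcal{Y}$. For $P\in\mathcal{P}$ with marginal $P_X$ on $\mathcal{X}$, write $R_P(f)=P(f(X)\neq Y)$ and $R_{P,\mathcal{H}}=\inf_{h\in\mathcal{H}}R_P(h)$. The minimax expected excess risk for $\ell$ labeled and $u$ unlabeled examples is $$L(\ell,u,\mathcal{H},\mathcal{P})=\inf_{A}\ \sup_{P\in\mathcal{P}}\ \mathbb{E}_{S\sim P^{\ell}\times P_X^{u}}\bigl[(R_P(A(S))-R_{P,\mathcal{H}})_+\bigr],$$ where $A$ ranges over all (measurable) maps $(\mathcal{X}\times\mathcal{Y})^{\ell}\times\mathcal{X}^{u}\to\mathcal{Y}^{\mathcal{X}}$. Write $f(\ell)\asymp g(\ell)$ if there are constants $c_1,c_2>0$ with $c_1g(\ell)\le f(\ell)\le c_2g(\ell)$ for all $\ell\ge 1$. Let $(\mathcal{H}_A,\mathcal{P}_A)$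 be the two-point problem: $\mathcal{X}_A=\{x_1,x_2\}$, $\mathcal{H}_A=\{0,1\}^{\mathcal{X}_A}$, and $\mathcal{P}_A$ is the set of all $P$ with $P_X(x_i)>0$ and $P(Y=1\mid X=x_i)=P_X(x_i)$ for $i=1,2$. For a hypothesis class $\mathcal{H}_B$ on a domain $\mathcal{X}_B$ disjoint from $\mathcal{X}_A$, let $\mathcal{P}_B$ be the set of all distributions $P$ on $\mathcal{X}_B\times\mathcal{Y}$ that are realizable, i.e. $R_P(h)=0$ for some $h\in\mathcal{H}_B$. The mixture problem on $\mathcal{X}_A\cup\mathcal{X}_B$ is $$\mathcal{H}=\{h:\ h|_{\mathcal{X}_A}\in\mathcal{H}_A,\ h|_{\mathcal{X}_B}\in\mathcal{H}_B\},\qquad \mathcal{P}=\{\tfrac12P_A+\tfrac12P_B:\ P_A\in\mathcal{P}_A,\ P_B\in\mathcal{P}_B\}.$$ **Theorem.** There exist a domain $\mathcal{X}_B$ and a hypothesis class $\mathcal{H}_B$ of finite VC dimension on it such that the mixture problem $(\mathcal{H},\mathcal{P})$ has the following properties. 1. $\mathcal{H}$ has finite VC dimension. 2. The supervised rate is $1/\sqrt{\ell}$: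 $L(\ell,0,\mathcal{H},\mathcal{P})\asymp 1/\sqrt{\ell}$. 3. For every $u:\mathbb{N}\to\mathbb{N}$ with $u(\ell)\ge\ell^2$ for all $\ell$, the semi-supervised rate is $1/\ell$: $L(\ell,u(\ell),\mathcal{H},\mathcal{P})\asymp 1/\ell$. 4. The rate cannot be improved beyond $1/\ell$ by more unlabeled data: there is a constant $c>0$ such that $L(\ell,u(\ell),\mathcal{H},\mathcal{P})\ge c/\ell$ for every function $u:\mathbb{N}\to\mathbb{N}$ and every $\ell\ge1$. -/

import Mathlib

open MeasureTheory ProbabilityTheory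
open scoped ENNReal

namespace SSL

noncomputable section

/-- A learning problem on the feature space `X` with labels `{0, 1}` (`false` is `0`, `true` is
`1`): a hypothesis class and a set of admissible distributions on `X × {0, 1}`. -/
structure LearningProblem (X : Type) [MeasurableSpace X] where
  hyp : Set (X → Bool)
  measurable_hyp : ∀ h ∈ hyp, Measurable h
  dist : Set (ProbabilityMeasure (X × Bool))

/-- The class `H` shatters the finite set `s`: each labelling of `s` is induced by some `h ∈ H`. -/
def Shatters {X : Type} (H : Set (X → Bool)) (s : Finset X) : Prop :=
  ∀ g : X → Bool, ∃ h ∈ H, ∀ x ∈ s, h x = g x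

/-- `H` has finite VC dimension: the sizes of the shattered finite sets are bounded. -/
def HasFiniteVCDim {X : Type} (H : Set (X → Bool)) : Prop :=
  ∃ d : ℕ, ∀ s : Finset X, Shatters H s → s.card ≤ d

variable {X : Type} [MeasurableSpace X]

/-- The misclassification probability `R_P(f) = P(f(X) ≠ Y)`. -/
def risk (P : ProbabilityMeasure (X × Bool)) (f : X → Bool) : ℝ≥0∞ :=
  (P : Measure (X × Bool)) {z | f z.1 ≠ z.2}

/-- The minimal risk `R_{P,H}` over the hypotheses in `H`. -/
def bestRisk (P : ProbabilityMeasure (X × Bool)) (H : Set (X → Bool)) : ℝ≥0∞ :=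
  ⨅ h ∈ H, risk P h

/-- Samples made of `l` labeled and `u` unlabeled points. -/
abbrev Sample (X : Type) (l u : ℕ) : Type := (Fin l → X × Bool) × (Fin u → X)

/-- The distribution `P^l × P_X^u` of the sample. -/
def sampleMeasure (P : ProbabilityMeasure (X × Bool)) (l u : ℕ) : Measure (Sample X l u) :=
  (Measure.pi fun _ : Fin l => (P : Measure (X × Bool))).prod
    (Measure.pi fun _ : Fin u => (P : Measure (X × Bool)).map Prod.fst)

/-- A (semi-supervised) learning algorithm on samples of size `(l, u)`: it maps a sample to a
classifier, not necessarily in the hypothesis class. The predicted label depends measurably on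
the sample and the point, so that the risk of the output has an expectation. -/
structure Learner (X : Type) [MeasurableSpace X] (l u : ℕ) where
  toFun : Sample X l u → X → Bool
  measurable_toFun : Measurable fun p : Sample X l u × X => toFun p.1 p.2

/-- The expected excess risk `E_{S ∼ P^l × P_X^u} (R_P(A(S)) - R_{P,H})_+`. Subtraction in `ℝ≥0∞`
is truncated at `0`, which is the positive part. -/
def expectedExcessRisk {l u : ℕ} (A : Learner X l u) (H : Set (X → Bool))
    (P : ProbabilityMeasure (X × Bool)) : ℝ≥0∞ :=
  ∫⁻ S, (risk P (A.toFun S) - bestRisk P H) ∂(sampleMeasure P l u)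

/-- The minimax expected excess risk `L(l, u, H, 𝒫)`. -/
def LearningProblem.minimaxRisk (Q : LearningProblem X) (l u : ℕ) : ℝ≥0∞ :=
  ⨅ A : Learner X l u, ⨆ P ∈ Q.dist, expectedExcessRisk A Q.hyp P

/-- `f` has rate `g`: `c₁ g(l) ≤ f(l) ≤ c₂ g(l)` for all sample sizes `l ≥ 1`, with constants
`c₁, c₂ > 0`. -/
def HasRate (f : ℕ → ℝ≥0∞) (g : ℕ → ℝ) : Prop :=
  ∃ c₁ c₂ : ℝ, 0 < c₁ ∧ 0 < c₂ ∧ ∀ l : ℕ, 1 ≤ l →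
    ENNReal.ofReal (c₁ * g l) ≤ f l ∧ f l ≤ ENNReal.ofReal (c₂ * g l)

/-- The two-point problem: the domain is `{x₁, x₂}`, all classifiers are hypotheses, and the
admissible distributions give positive mass to both points and satisfy
`P(Y = 1 | x) = P_X(x)` at each of them. -/
def twoPointProblem : LearningProblem (Fin 2) where
  hyp := Set.univ
  measurable_hyp := fun _ _ => measurable_of_finite _
  dist := {P | ∀ x : Fin 2, (P : Measure (Fin 2 × Bool)) {z | z.1 = x} ≠ 0 ∧
    (P : Measure (Fin 2 × Bool))[{z | z.2 = true} | {z | z.1 = x}] =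
      (P : Measure (Fin 2 × Bool)) {z | z.1 = x}}

/-- The problem of learning `H` under the realizability assumption: all distributions for which
some hypothesis in `H` has risk zero are admissible. -/
def realizableProblem (H : Set (X → Bool)) (hH : ∀ h ∈ H, Measurable h) : LearningProblem X where
  hyp := H
  measurable_hyp := hH
  dist := {P | ∃ h ∈ H, risk P h = 0}

/-- The mixture of two problems, on the disjoint union of their domains: the hypotheses restrict
to hypotheses of the components, and the distributions are `½ P_A + ½ P_B`. -/
def mixtureProblem {XA XB : Type} [MeasurableSpace XA] [MeasurableSpace XB]
    (A : LearningProblem XA) (B : LearningProblem XB) : LearningProblem (XA ⊕ XB) where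
  hyp := {h | h ∘ Sum.inl ∈ A.hyp ∧ h ∘ Sum.inr ∈ B.hyp}
  measurable_hyp := fun _ hh =>
    measurable_fun_sum (A.measurable_hyp _ hh.1) (B.measurable_hyp _ hh.2)
  dist := {P | ∃ PA ∈ A.dist, ∃ PB ∈ B.dist, (P : Measure ((XA ⊕ XB) × Bool)) =
    (2⁻¹ : ℝ≥0∞) • (PA : Measure (XA × Bool)).map (Prod.map Sum.inl id) +
    (2⁻¹ : ℝ≥0∞) • (PB : Measure (XB × Bool)).map (Prod.map Sum.inr id)}

end

end SSL

namespace SSL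

/-! Take for the second component two points with all classifiers. Write `p` for the mass of the
first point of the two-point problem. Its Bayes classifier labels the two points oppositely,
according to the sign of `p - 1/2`, and the opposite choice costs `|p - 1/2|` in the mixture. The
marginal alone determines this sign. An empirical mean over `n` points misjudges it at expected cost
at most `1/√n`, whether the points are labeled or not: `1/√l` from `l` labeled points, `1/l` from `l
^ 2` unlabeled ones. The realizable component costs at most `2/l`, the expected mass of points not
yet seen (`weightExpectedExcess_splitLearner_le`).

Both lower bounds are instances of Le Cam's two-point method in Hellinger form
(`affinity_le_minimaxRisk`). The supervised one compares `p = 1/2 ± δ` with `δ` of order `1/√l`. The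
other changes the label of a point of mass of order `1/l` in the realizable component; this leaves
the marginal unchanged, so unlabeled data carry no information about it.

Since the domain is finite, measures are replaced by real weight functions and expectations by
finite sums (`HasWeights`, `productMean`). -/

instance measurableSingletonClass_sum {α β : Type*} [MeasurableSpace α] [MeasurableSpace β]
    [MeasurableSingletonClass α] [MeasurableSingletonClass β] :
    MeasurableSingletonClass (α ⊕ β) where
  measurableSet_singleton x := by
    rcases x with a | b
    · simpa using (measurableSet_singleton a).inl_image (β := β)
    · simpa using (measurableSet_singleton b).inr_image (α := α)

noncomputable section

/-! ### Expectations under finite product distributions -/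

section ProductWeights

variable {Z : Type*} [Fintype Z]

/-- The expectation of `F` under the `n`-fold product of the weight function `w`. -/
def productMean (w : Z → ℝ) (n : ℕ) (F : (Fin n → Z) → ℝ) : ℝ :=
  ∑ S : Fin n → Z, (∏ i, w (S i)) * F S

theorem sum_fin_succ_fun {n : ℕ} (F : (Fin (n + 1) → Z) → ℝ) :
    ∑ S, F S = ∑ z, ∑ S : Fin n → Z, F (Fin.cons z S) := by
  rw [← (Fin.consEquiv fun _ : Fin (n + 1) => Z).sum_comp, Fintype.sum_prod_type]
  rfl

theorem sum_prod_weight_eq_one {w : Z → ℝ} (hw : ∑ z, w z = 1) (n : ℕ) :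
    ∑ S : Fin n → Z, ∏ i, w (S i) = 1 := by
  rw [← Fintype.sum_pow, hw, one_pow]

theorem productMean_succ (w : Z → ℝ) (n : ℕ) (F : (Fin (n + 1) → Z) → ℝ) :
    productMean w (n + 1) F = ∑ z, w z * productMean w n fun S => F (Fin.cons z S) := by
  simp only [productMean, sum_fin_succ_fun, Fin.prod_univ_succ, Fin.cons_zero, Fin.cons_succ,
    Finset.mul_sum, mul_assoc]

theorem productMean_add (w : Z → ℝ) (n : ℕ) (F G : (Fin n → Z) → ℝ) :
    (productMean w n fun S => F S + G S) = productMean w n F + productMean w n G := by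
  simp only [productMean, mul_add, Finset.sum_add_distrib]

theorem productMean_const_mul (w : Z → ℝ) (n : ℕ) (c : ℝ) (F : (Fin n → Z) → ℝ) :
    (productMean w n fun S => c * F S) = c * productMean w n F := by
  simp only [productMean, Finset.mul_sum]
  exact Finset.sum_congr rfl fun _ _ => by ring

theorem productMean_const {w : Z → ℝ} (hw : ∑ z, w z = 1) (n : ℕ) (c : ℝ) :
    (productMean w n fun _ => c) = c := by
  rw [productMean, ← Finset.sum_mul, sum_prod_weight_eq_one hw, one_mul]

theorem productMean_mono {w : Z → ℝ} (hw : ∀ z, 0 ≤ w z) (n : ℕ) {F G : (Fin n → Z) → ℝ}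
    (h : ∀ S, F S ≤ G S) : productMean w n F ≤ productMean w n G :=
  Finset.sum_le_sum fun S _ =>
    mul_le_mul_of_nonneg_left (h S) (Finset.prod_nonneg fun i _ => hw (S i))

theorem productMean_sum_eq_zero {w : Z → ℝ} (hw : ∑ z, w z = 1) {f : Z → ℝ}
    (hf : ∑ z, w z * f z = 0) (n : ℕ) : (productMean w n fun S => ∑ i, f (S i)) = 0 := by
  induction n with
  | zero => simp [productMean]
  | succ n ih =>
    simp only [productMean_succ, Fin.sum_univ_succ, Fin.cons_zero, Fin.cons_succ,
      productMean_add, ih, productMean_const hw, add_zero, hf]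

/-- Variances of independent centered variables add: splitting off the first coordinate, the cross
term vanishes by `productMean_sum_eq_zero`. -/
theorem productMean_sq_sum {w : Z → ℝ} (hw : ∑ z, w z = 1) {f : Z → ℝ}
    (hf : ∑ z, w z * f z = 0) (n : ℕ) :
    (productMean w n fun S => (∑ i, f (S i)) ^ 2) = n * ∑ z, w z * f z ^ 2 := by
  induction n with
  | zero => simp [productMean]
  | succ n ih =>
    simp only [productMean_succ, Fin.sum_univ_succ, Fin.cons_zero, Fin.cons_succ, add_sq,
      productMean_add, productMean_const_mul, productMean_sum_eq_zero hw hf, ih,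
      productMean_const hw, mul_zero, add_zero, mul_add, Finset.sum_add_distrib,
      ← Finset.sum_mul, hw]
    push_cast
    ring

/-- The mean absolute deviation of an empirical mean of `[-1, 1]`-valued variables. -/
theorem productMean_abs_empirical_sub_le {w : Z → ℝ} (hw0 : ∀ z, 0 ≤ w z) (hw : ∑ z, w z = 1)
    {g : Z → ℝ} (hg : ∀ z, |g z| ≤ 1) {n : ℕ} (hn : 1 ≤ n) :
    (productMean w n fun S => |(∑ i, g (S i)) / n - ∑ z, w z * g z|) ≤ 1 / Real.sqrt n := by
  set m := ∑ z, w z * g z with hm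
  have hn0 : (0 : ℝ) < n := by exact_mod_cast hn
  have hcentered : ∑ z, w z * (g z - m) = 0 := by
    simp only [mul_sub, Finset.sum_sub_distrib, ← Finset.sum_mul, hw, ← hm]
    ring
  have hvar : ∑ z, w z * (g z - m) ^ 2 ≤ 1 := by
    have h1 : ∑ z, w z * (g z - m) ^ 2 = ∑ z, w z * g z ^ 2 - m ^ 2 := by
      have : ∀ z, w z * (g z - m) ^ 2 = w z * g z ^ 2 - 2 * m * (w z * g z) + w z * m ^ 2 :=
        fun z => by ring
      simp only [this, Finset.sum_add_distrib, Finset.sum_sub_distrib, ← Finset.mul_sum,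
        ← Finset.sum_mul, hw, ← hm]
      ring
    have h2 : ∑ z, w z * g z ^ 2 ≤ ∑ z, w z := Finset.sum_le_sum fun z _ =>
      mul_le_of_le_one_right (hw0 z) ((sq_le_one_iff_abs_le_one _).2 (hg z))
    nlinarith [sq_nonneg m]
  have heq : ∀ S : Fin n → Z, (∑ i, g (S i)) / n - m = (∑ i, (g (S i) - m)) / n := fun S => by
    rw [Finset.sum_sub_distrib]
    simp
    field_simp
  -- Cauchy–Schwarz against the constant `1` bounds the mean absolute deviation by the standard
  -- deviation.
  have hCS : (productMean w n fun S => |(∑ i, g (S i)) / n - m|) ^ 2 ≤ 1 / n := by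
    calc _ ≤ (∑ S : Fin n → Z, ∏ i, w (S i)) *
          productMean w n fun S => ((∑ i, g (S i)) / n - m) ^ 2 := by
          refine Finset.sum_sq_le_sum_mul_sum_of_sq_le_mul _
            (fun S _ => Finset.prod_nonneg fun i _ => hw0 _)
            (fun S _ => mul_nonneg (Finset.prod_nonneg fun i _ => hw0 _) (sq_nonneg _))
            fun S _ => ?_
          rw [mul_pow, sq_abs]
          exact le_of_eq (by ring)
      _ = (1 / n) ^ 2 * productMean w n fun S => (∑ i, (g (S i) - m)) ^ 2 := by
          rw [sum_prod_weight_eq_one hw, one_mul, ← productMean_const_mul]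
          congr 1
          funext S
          rw [heq]
          ring
      _ = (1 / n) * ∑ z, w z * (g z - m) ^ 2 := by
          rw [productMean_sq_sum hw hcentered]
          field_simp
      _ ≤ 1 / n := mul_le_of_le_one_right (by positivity) hvar
  refine le_of_sq_le_sq ?_ (by positivity)
  rwa [div_pow, one_pow, Real.sq_sqrt hn0.le]

/-- By Bernoulli, `(1 + n t)(1 - t) ^ n ≤ (1 - t ^ 2) ^ n ≤ 1`. With `t` a point mass, this bounds
the expected missing mass. -/
theorem mul_one_sub_pow_le {t : ℝ} (h0 : 0 ≤ t) (h1 : t ≤ 1) {n : ℕ} (hn : 1 ≤ n) :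
    t * (1 - t) ^ n ≤ 1 / n := by
  have hn0 : (0 : ℝ) < n := by exact_mod_cast hn
  have hB : 1 + n * t ≤ (1 + t) ^ n := one_add_mul_le_pow (by linarith) n
  have hprod : (1 + t) ^ n * (1 - t) ^ n ≤ 1 := by
    rw [← mul_pow]
    exact pow_le_one₀ (by nlinarith) (by nlinarith)
  have hpow : 0 ≤ (1 - t) ^ n := pow_nonneg (by linarith) n
  rw [le_div_iff₀ hn0]
  nlinarith [mul_le_mul_of_nonneg_right hB hpow]

/-- The probability that an `n`-fold sample misses a point. -/
theorem productMean_indicator_missing [DecidableEq Z] {w : Z → ℝ} (hw : ∑ z, w z = 1) (z₀ : Z)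
    (n : ℕ) :
    (productMean w n fun S => if ∃ i, S i = z₀ then 0 else 1) = (1 - w z₀) ^ n := by
  have h : 1 - w z₀ = ∑ z, w z * if z = z₀ then 0 else 1 := by
    have : ∀ z, (w z * if z = z₀ then 0 else 1) = w z - if z = z₀ then w z else 0 := fun z => by
      split_ifs <;> simp
    simp [this, hw]
  rw [h, Fintype.sum_pow, productMean]
  refine Finset.sum_congr rfl fun S _ => ?_
  rw [Finset.prod_mul_distrib]
  congr 1
  split_ifs with hS
  · obtain ⟨i, hi⟩ := hS
    exact (Finset.prod_eq_zero (Finset.mem_univ i) (by simp [hi])).symm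
  · push Not at hS
    simp [hS]

end ProductWeights

/-! ### Learning all classifiers on a finite domain -/

section FiniteDomain

variable {X : Type}

/-- The marginal weights on the domain. -/
def marginalWeight (w : X × Bool → ℝ) (x : X) : ℝ := w (x, true) + w (x, false)

section

variable [Fintype X]

/-- The excess risk of `f` over all classifiers when the distribution has weights `w`. -/
def weightExcess (w : X × Bool → ℝ) (f : X → Bool) : ℝ :=
  ∑ x, (w (x, !f x) - min (w (x, true)) (w (x, false)))

theorem weightExcess_nonneg (w : X × Bool → ℝ) (f : X → Bool) : 0 ≤ weightExcess w f :=
  Finset.sum_nonneg fun x _ => by cases f x <;> simp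

theorem sum_marginalWeight (w : X × Bool → ℝ) : ∑ x, marginalWeight w x = ∑ z, w z := by
  simp [marginalWeight, Fintype.sum_prod_type]

/-- The expected excess risk, over all classifiers, when the distribution has weights `w`. -/
def weightExpectedExcess (w : X × Bool → ℝ) {l u : ℕ} (A : Sample X l u → X → Bool) : ℝ :=
  productMean w l fun S => productMean (marginalWeight w) u fun T => weightExcess w (A (S, T))

end

variable [MeasurableSpace X] {P : ProbabilityMeasure (X × Bool)} {w : X × Bool → ℝ}

/-- `P` has weights `w`. -/
structure HasWeights (P : ProbabilityMeasure (X × Bool)) (w : X × Bool → ℝ) : Prop where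
  nonneg : ∀ z, 0 ≤ w z
  apply_singleton : ∀ z, (P : Measure (X × Bool)) {z} = ENNReal.ofReal (w z)

theorem HasWeights.marginalWeight_nonneg (hP : HasWeights P w) (x : X) : 0 ≤ marginalWeight w x :=
  add_nonneg (hP.nonneg _) (hP.nonneg _)

variable [MeasurableSingletonClass X]

theorem HasWeights.apply_finset (hP : HasWeights P w) (s : Finset (X × Bool)) :
    (P : Measure (X × Bool)) s = ENNReal.ofReal (∑ z ∈ s, w z) := by
  rw [← sum_measure_singleton, ENNReal.ofReal_sum_of_nonneg fun z _ => hP.nonneg z]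
  exact Finset.sum_congr rfl fun z _ => hP.apply_singleton z

theorem HasWeights.map_fst_singleton (hP : HasWeights P w) (x : X) :
    (P : Measure (X × Bool)).map Prod.fst {x} = ENNReal.ofReal (marginalWeight w x) := by
  classical
  rw [Measure.map_apply measurable_fst (measurableSet_singleton x)]
  have h : (Prod.fst ⁻¹' {x} : Set (X × Bool)) = ({(x, true), (x, false)} : Finset (X × Bool)) := by
    ext ⟨y, b⟩
    cases b <;> simp
  rw [h, hP.apply_finset, Finset.sum_pair (by simp), marginalWeight]

variable [Fintype X]

namespace HasWeights

theorem sum_eq_one (hP : HasWeights P w) : ∑ z, w z = 1 := by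
  have h := hP.apply_finset Finset.univ
  rw [Finset.coe_univ, measure_univ, eq_comm, ENNReal.ofReal_eq_one] at h
  exact h

theorem sum_marginalWeight_eq_one (hP : HasWeights P w) : ∑ x, marginalWeight w x = 1 := by
  rw [sum_marginalWeight, hP.sum_eq_one]

theorem risk_eq (hP : HasWeights P w) (f : X → Bool) :
    risk P f = ENNReal.ofReal (∑ x, w (x, !f x)) := by
  classical
  have h : {z : X × Bool | f z.1 ≠ z.2} =
      ((Finset.univ.image fun x => (x, !f x) : Finset (X × Bool)) : Set (X × Bool)) := by
    ext ⟨y, b⟩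
    cases b <;> cases hf : f y <;> simp [hf]
  rw [risk, h, hP.apply_finset, Finset.sum_image fun x _ y _ h => (Prod.ext_iff.1 h).1]

theorem bestRisk_univ (hP : HasWeights P w) :
    bestRisk P Set.univ = ENNReal.ofReal (∑ x, min (w (x, true)) (w (x, false))) := by
  refine le_antisymm ?_ (le_iInf₂ fun f _ => ?_)
  · refine (iInf₂_le (fun x => decide (w (x, false) ≤ w (x, true))) (Set.mem_univ _)).trans ?_
    rw [hP.risk_eq]
    refine ENNReal.ofReal_le_ofReal (Finset.sum_le_sum fun x _ => ?_)
    by_cases h : w (x, false) ≤ w (x, true)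
    · simp [h]
    · simp [h, (not_le.1 h).le]
  · rw [hP.risk_eq]
    refine ENNReal.ofReal_le_ofReal (Finset.sum_le_sum fun x _ => ?_)
    cases f x <;> simp

theorem risk_sub_bestRisk_univ (hP : HasWeights P w) (f : X → Bool) :
    risk P f - bestRisk P Set.univ = ENNReal.ofReal (weightExcess w f) := by
  rw [hP.risk_eq, hP.bestRisk_univ, ← ENNReal.ofReal_sub, weightExcess, Finset.sum_sub_distrib]
  exact Finset.sum_nonneg fun x _ => le_min (hP.nonneg _) (hP.nonneg _)

theorem sampleMeasure_singleton (hP : HasWeights P w) {l u : ℕ} (S : Sample X l u) :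
    sampleMeasure P l u {S} =
      ENNReal.ofReal ((∏ i, w (S.1 i)) * ∏ j, marginalWeight w (S.2 j)) := by
  have : IsProbabilityMeasure ((P : Measure (X × Bool)).map Prod.fst) :=
    Measure.isProbabilityMeasure_map measurable_fst.aemeasurable
  have h : ({S} : Set (Sample X l u)) = {S.1} ×ˢ {S.2} := by simp
  rw [h, sampleMeasure, Measure.prod_prod, Measure.pi_singleton, Measure.pi_singleton,
    ENNReal.ofReal_mul (Finset.prod_nonneg fun i _ => hP.nonneg _),
    ENNReal.ofReal_prod_of_nonneg fun i _ => hP.nonneg _,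
    ENNReal.ofReal_prod_of_nonneg fun i _ => hP.marginalWeight_nonneg _]
  simp only [hP.apply_singleton, hP.map_fst_singleton]

/-- The bridge from the Lebesgue integral to real finite sums, on which all later estimates take
place. -/
theorem expectedExcessRisk_univ (hP : HasWeights P w) {l u : ℕ} (A : Learner X l u) :
    expectedExcessRisk A Set.univ P = ENNReal.ofReal (weightExpectedExcess w A.toFun) := by
  classical
  have hprod : ∀ S : Sample X l u, 0 ≤ (∏ i, w (S.1 i)) * ∏ j, marginalWeight w (S.2 j) :=
    fun S => mul_nonneg (Finset.prod_nonneg fun i _ => hP.nonneg _)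
      (Finset.prod_nonneg fun i _ => hP.marginalWeight_nonneg _)
  rw [expectedExcessRisk, lintegral_fintype]
  simp only [hP.risk_sub_bestRisk_univ, hP.sampleMeasure_singleton,
    ← ENNReal.ofReal_mul (weightExcess_nonneg _ _)]
  rw [← ENNReal.ofReal_sum_of_nonneg
    fun S _ => mul_nonneg (weightExcess_nonneg _ _) (hprod S), Fintype.sum_prod_type]
  simp only [weightExpectedExcess, productMean, Finset.mul_sum]
  congr 1
  exact Finset.sum_congr rfl fun S _ => Finset.sum_congr rfl fun T _ => by ring

end HasWeights

theorem exists_hasWeights {w : X × Bool → ℝ} (h0 : ∀ z, 0 ≤ w z) (h1 : ∑ z, w z = 1) :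
    ∃ P : ProbabilityMeasure (X × Bool), HasWeights P w := by
  classical
  let μ : Measure (X × Bool) := ∑ z, ENNReal.ofReal (w z) • Measure.dirac z
  have hμ : IsProbabilityMeasure μ := ⟨by
    simp [μ, ← ENNReal.ofReal_sum_of_nonneg fun z _ => h0 z, h1]⟩
  refine ⟨⟨μ, hμ⟩, h0, fun z => ?_⟩
  change μ {z} = _
  simp only [μ, Measure.coe_finsetSum, Finset.sum_apply, Measure.smul_apply, smul_eq_mul]
  rw [Finset.sum_eq_single z]
  · simp
  · intro y _ hy
    simp [hy]
  · simp

/-- The two-point lower bound, in terms of the Hellinger affinities of two distributions. -/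
theorem affinity_le_weightExpectedExcess_add {w₀ w₁ g : X × Bool → ℝ} {gX : X → ℝ}
    {P₀ P₁ : ProbabilityMeasure (X × Bool)} (h₀ : HasWeights P₀ w₀) (h₁ : HasWeights P₁ w₁)
    (hg : ∀ z, g z ^ 2 ≤ w₀ z * w₁ z)
    (hgX : ∀ x, gX x ^ 2 ≤ marginalWeight w₀ x * marginalWeight w₁ x) {c : ℝ} (hc : 0 ≤ c)
    (hsep : ∀ f, c ≤ weightExcess w₀ f + weightExcess w₁ f) {l u : ℕ}
    (A : Sample X l u → X → Bool) :
    c * ((∑ z, g z) ^ l * (∑ x, gX x) ^ u) ^ 2 / 2 ≤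
      weightExpectedExcess w₀ A + weightExpectedExcess w₁ A := by
  let W : (X × Bool → ℝ) → Sample X l u → ℝ :=
    fun w S => (∏ i, w (S.1 i)) * ∏ j, marginalWeight w (S.2 j)
  have hW : ∀ {P w}, HasWeights P w → ∀ S, 0 ≤ W w S := fun h S =>
    mul_nonneg (Finset.prod_nonneg fun i _ => h.nonneg _)
      (Finset.prod_nonneg fun i _ => h.marginalWeight_nonneg _)
  have hW1 : ∀ {P w}, HasWeights P w → ∑ S, W w S = 1 := fun h => by
    rw [Fintype.sum_prod_type]
    simp only [W, ← Finset.mul_sum, sum_prod_weight_eq_one h.sum_marginalWeight_eq_one, mul_one,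
      sum_prod_weight_eq_one h.sum_eq_one]
  have hE : ∀ w, weightExpectedExcess w A = ∑ S, W w S * weightExcess w (A S) := fun w => by
    rw [Fintype.sum_prod_type]
    simp only [weightExpectedExcess, productMean, Finset.mul_sum, W, mul_assoc]
  have haff : ((∑ z, g z) ^ l * (∑ x, gX x) ^ u) =
      ∑ S : Sample X l u, (∏ i, g (S.1 i)) * ∏ j, gX (S.2 j) := by
    rw [Fintype.sum_pow, Fintype.sum_pow, Finset.sum_mul_sum, Fintype.sum_prod_type]
  -- Since `min * max` is the product of the two weights, Cauchy–Schwarz bounds the squared affinity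
  -- by the overlap `∑ min` times `∑ max ≤ 2`. Only `g ^ 2 ≤ w₀ * w₁` is needed, so no square roots
  -- appear.
  have hCS : ((∑ z, g z) ^ l * (∑ x, gX x) ^ u) ^ 2 ≤
      (∑ S, min (W w₀ S) (W w₁ S)) * ∑ S, max (W w₀ S) (W w₁ S) := by
    rw [haff]
    refine Finset.sum_sq_le_sum_mul_sum_of_sq_le_mul _
      (fun S _ => le_min (hW h₀ S) (hW h₁ S)) (fun S _ => (hW h₀ S).trans (le_max_left _ _))
      fun S _ => ?_
    rw [min_mul_max, mul_pow, ← Finset.prod_pow, ← Finset.prod_pow]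
    calc _ ≤ (∏ i, w₀ (S.1 i) * w₁ (S.1 i)) *
          ∏ j, marginalWeight w₀ (S.2 j) * marginalWeight w₁ (S.2 j) :=
          mul_le_mul (Finset.prod_le_prod (fun _ _ => sq_nonneg _) fun i _ => hg _)
            (Finset.prod_le_prod (fun _ _ => sq_nonneg _) fun i _ => hgX _)
            (Finset.prod_nonneg fun _ _ => sq_nonneg _)
            (Finset.prod_nonneg fun i _ => mul_nonneg (h₀.nonneg _) (h₁.nonneg _))
      _ = W w₀ S * W w₁ S := by
          simp only [Finset.prod_mul_distrib, W]
          ring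
  have hmin0 : 0 ≤ ∑ S, min (W w₀ S) (W w₁ S) :=
    Finset.sum_nonneg fun S _ => le_min (hW h₀ S) (hW h₁ S)
  have hmax : ∑ S, max (W w₀ S) (W w₁ S) ≤ 2 := by
    calc _ ≤ ∑ S, (W w₀ S + W w₁ S) := Finset.sum_le_sum fun S _ =>
          max_le_add_of_nonneg (hW h₀ S) (hW h₁ S)
      _ = 2 := by rw [Finset.sum_add_distrib, hW1 h₀, hW1 h₁]; norm_num
  have hmain : c * ∑ S, min (W w₀ S) (W w₁ S) ≤
      weightExpectedExcess w₀ A + weightExpectedExcess w₁ A := by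
    rw [hE, hE, ← Finset.sum_add_distrib, Finset.mul_sum]
    refine Finset.sum_le_sum fun S _ => ?_
    have hm := le_min (hW h₀ S) (hW h₁ S)
    calc c * min (W w₀ S) (W w₁ S)
        ≤ (weightExcess w₀ (A S) + weightExcess w₁ (A S)) * min (W w₀ S) (W w₁ S) :=
          mul_le_mul_of_nonneg_right (hsep _) hm
      _ ≤ _ := by
          rw [add_mul, mul_comm (W w₀ S), mul_comm (W w₁ S)]
          exact add_le_add
            (mul_le_mul_of_nonneg_left (min_le_left _ _) (weightExcess_nonneg _ _))
            (mul_le_mul_of_nonneg_left (min_le_right _ _) (weightExcess_nonneg _ _))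
  have h2 := hCS.trans (mul_le_mul_of_nonneg_left hmax hmin0)
  nlinarith [mul_le_mul_of_nonneg_left h2 hc]

/-- The worse of the two distributions carries at least half of the summed risk, which turns the
factor `1/2` into `1/4`. -/
theorem affinity_le_minimaxRisk {Q : LearningProblem X} (hQ : Q.hyp = Set.univ)
    {w₀ w₁ g : X × Bool → ℝ} {gX : X → ℝ}
    {P₀ P₁ : ProbabilityMeasure (X × Bool)} (h₀ : HasWeights P₀ w₀) (h₁ : HasWeights P₁ w₁)
    (hP₀ : P₀ ∈ Q.dist) (hP₁ : P₁ ∈ Q.dist) (hg : ∀ z, g z ^ 2 ≤ w₀ z * w₁ z)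
    (hgX : ∀ x, gX x ^ 2 ≤ marginalWeight w₀ x * marginalWeight w₁ x) {c : ℝ} (hc : 0 ≤ c)
    (hsep : ∀ f, c ≤ weightExcess w₀ f + weightExcess w₁ f) (l u : ℕ) :
    ENNReal.ofReal (c * ((∑ z, g z) ^ l * (∑ x, gX x) ^ u) ^ 2 / 4) ≤ Q.minimaxRisk l u := by
  refine le_iInf fun A => ?_
  have h := affinity_le_weightExpectedExcess_add h₀ h₁ hg hgX hc hsep A.toFun
  rw [hQ]
  rcases le_total (weightExpectedExcess w₀ A.toFun) (weightExpectedExcess w₁ A.toFun) with hle | hle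
  · refine le_trans ?_ (le_iSup₂ (f := fun P _ => expectedExcessRisk A Set.univ P) P₁ hP₁)
    rw [h₁.expectedExcessRisk_univ]
    exact ENNReal.ofReal_le_ofReal (by linarith)
  · refine le_trans ?_ (le_iSup₂ (f := fun P _ => expectedExcessRisk A Set.univ P) P₀ hP₀)
    rw [h₀.expectedExcessRisk_univ]
    exact ENNReal.ofReal_le_ofReal (by linarith)

end FiniteDomain

/-! ### The distributions of the mixture problem -/

theorem hasWeights_real {X : Type} [MeasurableSpace X] (P : ProbabilityMeasure (X × Bool)) :
    HasWeights P fun z => (P : Measure (X × Bool)).real {z} where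
  nonneg _ := measureReal_nonneg
  apply_singleton _ := by simp

/-- Multiplying the conditional probability by the positive mass of the point makes the condition
polynomial. -/
theorem mem_twoPointProblem_dist_iff {P : ProbabilityMeasure (Fin 2 × Bool)}
    {a : Fin 2 × Bool → ℝ} (hP : HasWeights P a) :
    P ∈ twoPointProblem.dist ↔
      ∀ x, 0 < marginalWeight a x ∧ a (x, true) = marginalWeight a x ^ 2 := by
  refine forall_congr' fun x => ?_
  have hx : (P : Measure (Fin 2 × Bool)) {z | z.1 = x} = ENNReal.ofReal (marginalWeight a x) := by
    rw [← hP.map_fst_singleton, Measure.map_apply measurable_fst (measurableSet_singleton x)]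
    rfl
  have hinter : ({z | z.1 = x} ∩ {z | z.2 = true} : Set (Fin 2 × Bool)) = {(x, true)} := by
    ext ⟨y, b⟩
    simp
  rw [cond_apply (Set.toFinite _).measurableSet, hinter, hx, hP.apply_singleton, ne_eq,
    ENNReal.ofReal_eq_zero, not_le]
  refine and_congr_right fun hpos => ?_
  rw [← ENNReal.ofReal_inv_of_pos hpos, ← ENNReal.ofReal_mul (inv_nonneg.2 hpos.le),
    ENNReal.ofReal_eq_ofReal_iff (mul_nonneg (inv_nonneg.2 hpos.le) (hP.nonneg _)) hpos.le,
    inv_mul_eq_iff_eq_mul₀ hpos.ne', sq]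

theorem mem_realizableProblem_univ_dist_iff {X : Type} [Fintype X] [MeasurableSpace X]
    [MeasurableSingletonClass X] {hmeas : ∀ h ∈ (Set.univ : Set (X → Bool)), Measurable h}
    {P : ProbabilityMeasure (X × Bool)} {b : X × Bool → ℝ} (hP : HasWeights P b) :
    P ∈ (realizableProblem Set.univ hmeas).dist ↔ ∃ h : X → Bool, ∀ x, b (x, !h x) = 0 := by
  have : ∀ h : X → Bool, risk P h = 0 ↔ ∀ x, b (x, !h x) = 0 := fun h => by
    rw [hP.risk_eq, ENNReal.ofReal_eq_zero,
      (Finset.sum_nonneg fun x _ => hP.nonneg (x, !h x)).ge_iff_eq',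
      Finset.sum_eq_zero_iff_of_nonneg fun x _ => hP.nonneg (x, !h x)]
    simp
  simp [realizableProblem, this]

section Mixture

variable {XA XB : Type}

/-- The weights of the mixture of two distributions on the disjoint union of their domains. -/
def mixWeight (a : XA × Bool → ℝ) (b : XB × Bool → ℝ) : (XA ⊕ XB) × Bool → ℝ
  | (Sum.inl x, y) => a (x, y) / 2
  | (Sum.inr x, y) => b (x, y) / 2

theorem mixWeight_nonneg {a : XA × Bool → ℝ} {b : XB × Bool → ℝ} (ha : ∀ z, 0 ≤ a z)
    (hb : ∀ z, 0 ≤ b z) (z : (XA ⊕ XB) × Bool) : 0 ≤ mixWeight a b z := by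
  rcases z with ⟨x | x, y⟩
  · exact div_nonneg (ha _) two_pos.le
  · exact div_nonneg (hb _) two_pos.le

variable [MeasurableSpace XA] [MeasurableSpace XB] [MeasurableSingletonClass XA]
  [MeasurableSingletonClass XB]

theorem mixture_apply_singleton {PA : ProbabilityMeasure (XA × Bool)}
    {PB : ProbabilityMeasure (XB × Bool)} {a : XA × Bool → ℝ} {b : XB × Bool → ℝ}
    (hA : HasWeights PA a) (hB : HasWeights PB b) (z : (XA ⊕ XB) × Bool) :
    ((2⁻¹ : ℝ≥0∞) • (PA : Measure (XA × Bool)).map (Prod.map Sum.inl id) +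
      (2⁻¹ : ℝ≥0∞) • (PB : Measure (XB × Bool)).map (Prod.map Sum.inr id) :
      Measure ((XA ⊕ XB) × Bool)) {z} =
      ENNReal.ofReal (mixWeight a b z) := by
  have hl : Measurable (Prod.map Sum.inl id : XA × Bool → (XA ⊕ XB) × Bool) :=
    measurable_inl.prodMap measurable_id
  have hr : Measurable (Prod.map Sum.inr id : XB × Bool → (XA ⊕ XB) × Bool) :=
    measurable_inr.prodMap measurable_id
  have h2 : ∀ t : ℝ, ENNReal.ofReal (t / 2) = 2⁻¹ * ENNReal.ofReal t := fun t => by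
    rw [ENNReal.ofReal_div_of_pos two_pos, ENNReal.ofReal_ofNat, ENNReal.div_eq_inv_mul]
  simp only [Measure.add_apply, Measure.smul_apply, smul_eq_mul,
    Measure.map_apply hl (measurableSet_singleton z),
    Measure.map_apply hr (measurableSet_singleton z)]
  rcases z with ⟨x | x, y⟩
  · have e1 : (Prod.map Sum.inl id : XA × Bool → (XA ⊕ XB) × Bool) ⁻¹' {(Sum.inl x, y)} =
        {(x, y)} := by
      ext ⟨_, _⟩; simp
    have e2 : (Prod.map Sum.inr id : XB × Bool → (XA ⊕ XB) × Bool) ⁻¹' {(Sum.inl x, y)} = ∅ := by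
      ext ⟨_, _⟩; simp
    rw [e1, e2, hA.apply_singleton, mixWeight, h2, measure_empty, mul_zero, add_zero]
  · have e1 : (Prod.map Sum.inl id : XA × Bool → (XA ⊕ XB) × Bool) ⁻¹' {(Sum.inr x, y)} = ∅ := by
      ext ⟨_, _⟩; simp
    have e2 : (Prod.map Sum.inr id : XB × Bool → (XA ⊕ XB) × Bool) ⁻¹' {(Sum.inr x, y)} =
        {(x, y)} := by
      ext ⟨_, _⟩; simp
    rw [e1, e2, hB.apply_singleton, mixWeight, h2, measure_empty, mul_zero, zero_add]

theorem mem_mixtureProblem_dist_iff [Countable XA] [Countable XB] {A : LearningProblem XA}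
    {B : LearningProblem XB} {P : ProbabilityMeasure ((XA ⊕ XB) × Bool)} :
    P ∈ (mixtureProblem A B).dist ↔ ∃ PA ∈ A.dist, ∃ PB ∈ B.dist,
      ∃ a b, HasWeights PA a ∧ HasWeights PB b ∧ HasWeights P (mixWeight a b) := by
  refine exists_congr fun PA => and_congr_right fun _ => exists_congr fun PB =>
    and_congr_right fun _ => ⟨fun h => ?_, ?_⟩
  · refine ⟨_, _, hasWeights_real PA, hasWeights_real PB,
      mixWeight_nonneg (hasWeights_real PA).nonneg (hasWeights_real PB).nonneg, fun z => ?_⟩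
    rw [h]
    exact mixture_apply_singleton (hasWeights_real PA) (hasWeights_real PB) z
  · rintro ⟨a, b, hA, hB, hP⟩
    refine Measure.ext_of_singleton fun z => ?_
    rw [hP.apply_singleton, mixture_apply_singleton hA hB]

end Mixture

/-- The probabilities `s, 1 - s` on two points. -/
def pointMass (s : ℝ) (i : Fin 2) : ℝ := if i = 0 then s else 1 - s

/-- The weights of the admissible distribution of the two-point problem with `P_X(x₁) = p`. -/
def twoPointWeight (p : ℝ) (z : Fin 2 × Bool) : ℝ :=
  pointMass p z.1 * if z.2 then pointMass p z.1 else 1 - pointMass p z.1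

/-- The weights of the distribution with masses `q, 1 - q` and labels given by `h`. -/
def realizableWeight (q : ℝ) (h : Fin 2 → Bool) (z : Fin 2 × Bool) : ℝ :=
  if z.2 = h z.1 then pointMass q z.1 else 0

theorem pointMass_nonneg {s : ℝ} (h0 : 0 ≤ s) (h1 : s ≤ 1) (i : Fin 2) : 0 ≤ pointMass s i := by
  unfold pointMass
  split_ifs <;> linarith

theorem pointMass_pos {s : ℝ} (h0 : 0 < s) (h1 : s < 1) (i : Fin 2) : 0 < pointMass s i := by
  unfold pointMass
  split_ifs <;> linarith

theorem pointMass_le_one {s : ℝ} (h0 : 0 ≤ s) (h1 : s ≤ 1) (i : Fin 2) : pointMass s i ≤ 1 := by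
  unfold pointMass
  split_ifs <;> linarith

theorem pointMass_eq {m : Fin 2 → ℝ} (hm : ∑ i, m i = 1) (i : Fin 2) :
    pointMass (m 0) i = m i := by
  rw [Fin.sum_univ_two] at hm
  fin_cases i
  · simp [pointMass]
  · simp [pointMass, ← hm]

theorem marginalWeight_twoPointWeight (p : ℝ) (i : Fin 2) :
    marginalWeight (twoPointWeight p) i = pointMass p i := by
  simp [marginalWeight, twoPointWeight]
  ring

theorem marginalWeight_realizableWeight (q : ℝ) (h : Fin 2 → Bool) (i : Fin 2) :
    marginalWeight (realizableWeight q h) i = pointMass q i := by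
  cases hi : h i <;> simp [marginalWeight, realizableWeight, hi]

theorem twoPointWeight_nonneg {p : ℝ} (h0 : 0 ≤ p) (h1 : p ≤ 1) (z : Fin 2 × Bool) :
    0 ≤ twoPointWeight p z := by
  have := pointMass_nonneg h0 h1 z.1
  have := pointMass_le_one h0 h1 z.1
  unfold twoPointWeight
  split_ifs
  · positivity
  · exact mul_nonneg (by assumption) (by linarith)

theorem realizableWeight_nonneg {q : ℝ} (h0 : 0 ≤ q) (h1 : q ≤ 1) (h : Fin 2 → Bool)
    (z : Fin 2 × Bool) : 0 ≤ realizableWeight q h z := by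
  unfold realizableWeight
  split_ifs
  · exact pointMass_nonneg h0 h1 _
  · exact le_rfl

/-- The marginal fixes how each point's mass splits between the labels, so one parameter remains; it
is below `1` because the other point has positive mass. -/
theorem exists_eq_twoPointWeight {P : ProbabilityMeasure (Fin 2 × Bool)} {a : Fin 2 × Bool → ℝ}
    (hP : HasWeights P a) (hmem : P ∈ twoPointProblem.dist) :
    ∃ p, 0 < p ∧ p < 1 ∧ a = twoPointWeight p := by
  rw [mem_twoPointProblem_dist_iff hP] at hmem
  have hsum := hP.sum_marginalWeight_eq_one
  refine ⟨marginalWeight a 0, (hmem 0).1, ?_, ?_⟩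
  · rw [Fin.sum_univ_two] at hsum
    linarith [(hmem 1).1]
  · funext ⟨i, y⟩
    have h := (hmem i).2
    simp only [twoPointWeight, pointMass_eq hsum]
    cases y
    · have : a (i, false) = marginalWeight a i - a (i, true) := by simp [marginalWeight]
      rw [this, h]
      simp
      ring
    · rw [h]
      simp
      ring

theorem exists_eq_realizableWeight {P : ProbabilityMeasure (Fin 2 × Bool)}
    {b : Fin 2 × Bool → ℝ} (hP : HasWeights P b)
    {hmeas : ∀ h ∈ (Set.univ : Set (Fin 2 → Bool)), Measurable h}
    (hmem : P ∈ (realizableProblem Set.univ hmeas).dist) :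
    ∃ q h, 0 ≤ q ∧ q ≤ 1 ∧ b = realizableWeight q h := by
  obtain ⟨h, hh⟩ := (mem_realizableProblem_univ_dist_iff hP).1 hmem
  have hsum := hP.sum_marginalWeight_eq_one
  refine ⟨marginalWeight b 0, h, hP.marginalWeight_nonneg 0, ?_, ?_⟩
  · rw [Fin.sum_univ_two] at hsum
    linarith [hP.marginalWeight_nonneg 1]
  · funext ⟨i, y⟩
    have hi := hh i
    simp only [realizableWeight, pointMass_eq hsum]
    cases y <;> cases hhi : h i <;> simp only [hhi, Bool.not_true, Bool.not_false] at hi <;>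
      simp [marginalWeight, hi]

/-- The mixture problem whose second component is the realizable problem of learning an arbitrary
classifier on two points. -/
def twoPointMixture : LearningProblem (Fin 2 ⊕ Fin 2) :=
  mixtureProblem twoPointProblem (realizableProblem Set.univ fun _ _ => measurable_of_finite _)

theorem twoPointMixture_hyp : twoPointMixture.hyp = Set.univ :=
  Set.eq_univ_of_forall fun _ => ⟨Set.mem_univ _, Set.mem_univ _⟩

/-- The weights of the distributions of `twoPointMixture`. -/
abbrev mixtureWeight (p q : ℝ) (h : Fin 2 → Bool) : (Fin 2 ⊕ Fin 2) × Bool → ℝ :=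
  mixWeight (twoPointWeight p) (realizableWeight q h)

theorem exists_hasWeights_of_mem_dist {P : ProbabilityMeasure ((Fin 2 ⊕ Fin 2) × Bool)}
    (hP : P ∈ twoPointMixture.dist) :
    ∃ p q h, 0 < p ∧ p < 1 ∧ 0 ≤ q ∧ q ≤ 1 ∧ HasWeights P (mixtureWeight p q h) := by
  obtain ⟨PA, hPA, PB, hPB, a, b, hA, hB, hW⟩ := mem_mixtureProblem_dist_iff.1 hP
  obtain ⟨p, hp0, hp1, rfl⟩ := exists_eq_twoPointWeight hA hPA
  obtain ⟨q, h, hq0, hq1, rfl⟩ := exists_eq_realizableWeight hB hPB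
  exact ⟨p, q, h, hp0, hp1, hq0, hq1, hW⟩

theorem sum_mixWeight {XA XB : Type} [Fintype XA] [Fintype XB] (a : XA × Bool → ℝ)
    (b : XB × Bool → ℝ) : ∑ z, mixWeight a b z = (∑ z, a z) / 2 + (∑ z, b z) / 2 := by
  simp only [Fintype.sum_prod_type, Fintype.sum_sum_type, mixWeight, Finset.sum_div]

theorem exists_mem_dist_hasWeights {p q : ℝ} (h : Fin 2 → Bool) (hp0 : 0 < p) (hp1 : p < 1)
    (hq0 : 0 ≤ q) (hq1 : q ≤ 1) :
    ∃ P ∈ twoPointMixture.dist, HasWeights P (mixtureWeight p q h) := by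
  have hA1 : ∑ z, twoPointWeight p z = 1 := by
    rw [← sum_marginalWeight]
    simp only [marginalWeight_twoPointWeight]
    simp [pointMass]
  have hB1 : ∑ z, realizableWeight q h z = 1 := by
    rw [← sum_marginalWeight]
    simp only [marginalWeight_realizableWeight]
    simp [pointMass]
  obtain ⟨PA, hA⟩ := exists_hasWeights (twoPointWeight_nonneg hp0.le hp1.le) hA1
  obtain ⟨PB, hB⟩ := exists_hasWeights (realizableWeight_nonneg hq0 hq1 h) hB1
  obtain ⟨P, hP⟩ := exists_hasWeights (mixWeight_nonneg hA.nonneg hB.nonneg)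
    (by rw [sum_mixWeight, hA1, hB1]; norm_num)
  refine ⟨P, mem_mixtureProblem_dist_iff.2 ⟨PA, ?_, PB, ?_, _, _, hA, hB, hP⟩, hP⟩
  · refine (mem_twoPointProblem_dist_iff hA).2 fun x => ?_
    rw [marginalWeight_twoPointWeight]
    exact ⟨pointMass_pos hp0 hp1 x, by simp [twoPointWeight, sq]⟩
  · refine (mem_realizableProblem_univ_dist_iff hB).2 ⟨h, fun x => ?_⟩
    cases hx : h x <;> simp [realizableWeight, hx]

/-! ### Lower bounds -/

theorem weightExcess_term_le {X : Type} [Fintype X] (w : X × Bool → ℝ) (f : X → Bool) (x : X) :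
    w (x, !f x) - min (w (x, true)) (w (x, false)) ≤ weightExcess w f :=
  Finset.single_le_sum
    (f := fun x => w (x, !f x) - min (w (x, true)) (w (x, false)))
    (fun y _ => by cases f y <;> simp) (Finset.mem_univ x)

theorem supervised_lower_bound {l : ℕ} (hl : 1 ≤ l) :
    ENNReal.ofReal (1 / 256 * (1 / Real.sqrt l)) ≤ twoPointMixture.minimaxRisk l 0 := by
  have hl0 : (1 : ℝ) ≤ l := by exact_mod_cast hl
  have hs1 : 1 ≤ Real.sqrt l := Real.one_le_sqrt.2 hl0
  set δ : ℝ := 1 / (4 * Real.sqrt l) with hδ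
  have hδ0 : 0 < δ := by positivity
  have hδ4 : δ ≤ 1 / 4 := by
    rw [hδ]
    exact one_div_le_one_div_of_le (by norm_num) (by linarith)
  have hlδ : l * δ ^ 2 = 1 / 16 := by
    rw [hδ, div_pow, mul_pow, Real.sq_sqrt (by linarith)]
    field_simp
    norm_num
  let h : Fin 2 → Bool := fun _ => false
  obtain ⟨P₀, hm₀, hP₀⟩ := exists_mem_dist_hasWeights (p := 1 / 2 + δ) (q := 1) h (by linarith)
    (by linarith) (by norm_num) le_rfl
  obtain ⟨P₁, hm₁, hP₁⟩ := exists_mem_dist_hasWeights (p := 1 / 2 - δ) (q := 1) h (by linarith)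
    (by linarith) (by norm_num) le_rfl
  -- In the first component all four products of weights at `1/2 + δ` and `1/2 - δ` equal `(1/4 - δ
  -- ^ 2) ^ 2`; the second component is the same for both distributions. The affinity per labeled
  -- example is thus `1 - 2 δ ^ 2`.
  have hg : ∀ z, mixWeight (fun _ : Fin 2 × Bool => 1 / 4 - δ ^ 2) (realizableWeight 1 h) z ^ 2 ≤
      mixtureWeight (1 / 2 + δ) 1 h z * mixtureWeight (1 / 2 - δ) 1 h z := by
    rintro ⟨x | x, y⟩
    · refine le_of_eq ?_
      fin_cases x <;> cases y <;> simp [mixWeight, twoPointWeight, pointMass] <;> ring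
    · simp [mixWeight, sq]
  -- The first point alone suffices: either label there is wrong for one distribution, at cost `(1/2
  -- ± δ) δ`, and `δ ≤ 1/4`.
  have hsep : ∀ f, δ / 4 ≤ weightExcess (mixtureWeight (1 / 2 + δ) 1 h) f +
      weightExcess (mixtureWeight (1 / 2 - δ) 1 h) f := by
    intro f
    have e₀ := weightExcess_term_le (mixtureWeight (1 / 2 + δ) 1 h) f (Sum.inl 0)
    have e₁ := weightExcess_term_le (mixtureWeight (1 / 2 - δ) 1 h) f (Sum.inl 0)
    have n₀ := weightExcess_nonneg (mixtureWeight (1 / 2 + δ) 1 h) f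
    have n₁ := weightExcess_nonneg (mixtureWeight (1 / 2 - δ) 1 h) f
    cases hf : f (Sum.inl 0) <;>
      simp only [hf, mixWeight, twoPointWeight, pointMass, Bool.not_true, Bool.not_false, if_true,
        Bool.false_eq_true, if_false] at e₀ e₁
    · have := min_le_right ((1 / 2 + δ) * (1 / 2 + δ) / 2) ((1 / 2 + δ) * (1 - (1 / 2 + δ)) / 2)
      nlinarith
    · have := min_le_left ((1 / 2 - δ) * (1 / 2 - δ) / 2) ((1 / 2 - δ) * (1 - (1 / 2 - δ)) / 2)
      nlinarith
  have hsum : ∑ z, mixWeight (fun _ : Fin 2 × Bool => 1 / 4 - δ ^ 2) (realizableWeight 1 h) z =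
      1 + -(2 * δ ^ 2) := by
    rw [sum_mixWeight, ← sum_marginalWeight (realizableWeight 1 h)]
    simp only [marginalWeight_realizableWeight]
    simp [pointMass]
    ring
  -- Without unlabeled data the marginal affinity has exponent `0`, so `gX = 0` will do.
  refine le_trans (ENNReal.ofReal_le_ofReal ?_) (affinity_le_minimaxRisk twoPointMixture_hyp
    hP₀ hP₁ hm₀ hm₁ hg (gX := 0) (fun x => by
      simpa using mul_nonneg (hP₀.marginalWeight_nonneg x) (hP₁.marginalWeight_nonneg x))
    (by positivity) hsep l 0)
  have hB : 1 + l * -(2 * δ ^ 2) ≤ (1 + -(2 * δ ^ 2)) ^ l := one_add_mul_le_pow (by nlinarith) l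
  rw [hsum, pow_zero, mul_one]
  have hB' : 1 / 2 ≤ (1 + -(2 * δ ^ 2)) ^ l := by linarith
  have hsq : 1 / 4 ≤ ((1 + -(2 * δ ^ 2)) ^ l) ^ 2 := by nlinarith
  have hδ' : 1 / 256 * (1 / Real.sqrt l) = δ / 64 := by
    rw [hδ]
    field_simp
    norm_num
  rw [hδ']
  nlinarith

theorem semisupervised_lower_bound {l : ℕ} (hl : 1 ≤ l) (u : ℕ) :
    ENNReal.ofReal (1 / 32 * (1 / (l : ℝ))) ≤ twoPointMixture.minimaxRisk l u := by
  have hl0 : (1 : ℝ) ≤ l := by exact_mod_cast hl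
  set ε : ℝ := 1 / l with hε
  have hε0 : 0 < ε := by positivity
  have hε1 : ε ≤ 1 := by
    rw [hε]
    exact div_le_one_of_le₀ hl0 (by positivity)
  have hlε : l * ε = 1 := by
    rw [hε]
    field_simp
  let h₀ : Fin 2 → Bool := fun _ => false
  let h₁ : Fin 2 → Bool := fun j => decide (j = 1)
  obtain ⟨P₀, hm₀, hP₀⟩ := exists_mem_dist_hasWeights (p := 1 / 2) (q := 1 - ε) h₀ (by norm_num)
    (by norm_num) (by linarith) (by linarith)
  obtain ⟨P₁, hm₁, hP₁⟩ := exists_mem_dist_hasWeights (p := 1 / 2) (q := 1 - ε) h₁ (by norm_num)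
    (by norm_num) (by linarith) (by linarith)
  -- The two labelings disagree at the point `1`, whose mass therefore drops out of the affinity,
  -- leaving `1 - ε / 2` per labeled example.
  let b : Fin 2 × Bool → ℝ := fun z => if z = (0, false) then 1 - ε else 0
  have hg : ∀ z, mixWeight (twoPointWeight (1 / 2)) b z ^ 2 ≤
      mixtureWeight (1 / 2) (1 - ε) h₀ z * mixtureWeight (1 / 2) (1 - ε) h₁ z := by
    rintro ⟨x | x, y⟩
    · simp [mixWeight, sq]
    · refine le_of_eq ?_
      fin_cases x <;> cases y <;> simp [mixWeight, realizableWeight, pointMass, b, h₀, h₁, sq]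
  have hmarg : ∀ x, marginalWeight (mixtureWeight (1 / 2) (1 - ε) h₁) x =
      marginalWeight (mixtureWeight (1 / 2) (1 - ε) h₀) x := by
    rintro (x | x)
    · rfl
    · fin_cases x <;> simp [marginalWeight, mixWeight, realizableWeight, h₀, h₁]
  have hsep : ∀ f, ε / 2 ≤ weightExcess (mixtureWeight (1 / 2) (1 - ε) h₀) f +
      weightExcess (mixtureWeight (1 / 2) (1 - ε) h₁) f := by
    intro f
    have hε0' : 0 ≤ ε / 2 := by positivity
    have e₀ := weightExcess_term_le (mixtureWeight (1 / 2) (1 - ε) h₀) f (Sum.inr 1)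
    have e₁ := weightExcess_term_le (mixtureWeight (1 / 2) (1 - ε) h₁) f (Sum.inr 1)
    have n₀ := weightExcess_nonneg (mixtureWeight (1 / 2) (1 - ε) h₀) f
    have n₁ := weightExcess_nonneg (mixtureWeight (1 / 2) (1 - ε) h₁) f
    cases hf : f (Sum.inr 1) <;>
      simp [hf, mixWeight, realizableWeight, pointMass, h₀, h₁] at e₀ e₁ n₀ n₁ ⊢ <;>
      simp only [min_eq_left hε0', min_eq_right hε0'] at e₀ e₁ <;> linarith
  have hsum : ∑ z, mixWeight (twoPointWeight (1 / 2)) b z = 1 + -(ε / 2) := by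
    rw [sum_mixWeight, ← sum_marginalWeight (twoPointWeight _)]
    simp only [marginalWeight_twoPointWeight, b]
    simp [pointMass]
    ring
  refine le_trans (ENNReal.ofReal_le_ofReal ?_) (affinity_le_minimaxRisk twoPointMixture_hyp
    hP₀ hP₁ hm₀ hm₁ hg (fun x => by rw [hmarg, sq]) (by positivity) hsep l u)
  have hB : 1 + l * -(ε / 2) ≤ (1 + -(ε / 2)) ^ l := one_add_mul_le_pow (by linarith) l
  rw [hsum, hP₀.sum_marginalWeight_eq_one, one_pow, mul_one]
  have hB' : 1 / 2 ≤ (1 + -(ε / 2)) ^ l := by linarith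
  have hsq : 1 / 4 ≤ ((1 + -(ε / 2)) ^ l) ^ 2 := by nlinarith
  nlinarith

/-! ### Upper bounds -/

/-- The learner that predicts opposite labels at the first two points, according to `ψ`, and
predicts `1` at the other points exactly when it has seen them with this label. -/
def splitLearner {l u : ℕ}
    (ψ : (Fin l → (Fin 2 ⊕ Fin 2) × Bool) → (Fin u → Fin 2 ⊕ Fin 2) → Bool) :
    Learner (Fin 2 ⊕ Fin 2) l u where
  toFun S
    | Sum.inl i => if i = 0 then ψ S.1 S.2 else !ψ S.1 S.2
    | Sum.inr j => decide (∃ i, S.1 i = (Sum.inr j, true))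
  measurable_toFun := measurable_of_finite _

/-- In the first component both points are labeled correctly or both wrongly; the two costs, `p * |p
- 1/2|` and `(1 - p) * |p - 1/2|`, add up to `|p - 1/2|`. -/
theorem weightExcess_splitLearner {p q : ℝ} (hp0 : 0 ≤ p) (hp1 : p ≤ 1) (hq0 : 0 ≤ q)
    (hq1 : q ≤ 1) (h : Fin 2 → Bool) {l u : ℕ}
    (ψ : (Fin l → (Fin 2 ⊕ Fin 2) × Bool) → (Fin u → Fin 2 ⊕ Fin 2) → Bool)
    (S : Fin l → (Fin 2 ⊕ Fin 2) × Bool) (T : Fin u → Fin 2 ⊕ Fin 2) :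
    weightExcess (mixtureWeight p q h) ((splitLearner ψ).toFun (S, T)) =
      (if ψ S T then max 0 (-(p - 1 / 2)) else max 0 (p - 1 / 2)) +
      ∑ j, pointMass q j / 2 *
        (if decide (∃ i, S i = (Sum.inr j, true)) = h j then 0 else 1) := by
  rw [weightExcess, Fintype.sum_sum_type]
  congr 1
  · rw [Fin.sum_univ_two]
    cases hψ : ψ S T <;> rcases le_total p (1 / 2) with hp | hp <;>
      simp only [splitLearner, hψ, mixWeight, twoPointWeight, pointMass, Bool.not_true,
        Bool.not_false, if_true, Bool.false_eq_true, if_false, one_ne_zero]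
    · rw [min_eq_left (by nlinarith), min_eq_right (by nlinarith), max_eq_left (by linarith)]
      ring
    · rw [min_eq_right (by nlinarith), min_eq_left (by nlinarith), max_eq_right (by linarith)]
      ring
    · rw [min_eq_left (by nlinarith), min_eq_right (by nlinarith), max_eq_right (by linarith)]
      ring
    · rw [min_eq_right (by nlinarith), min_eq_left (by nlinarith), max_eq_left (by linarith)]
      ring
  · refine Finset.sum_congr rfl fun j _ => ?_
    have := pointMass_nonneg hq0 hq1 j
    have hj : 0 ≤ pointMass q j / 2 := by positivity
    simp only [splitLearner, mixWeight, realizableWeight]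
    cases h j <;> cases decide (∃ i, S i = (Sum.inr j, true)) <;> simp [hj]

/-- In the realizable component the default prediction `0` is never wrong at a point labeled `0`,
and a point labeled `1` is misclassified only if unseen. Each of the two points contributes at most
`1 / l`. -/
theorem weightExpectedExcess_splitLearner_le {P : ProbabilityMeasure ((Fin 2 ⊕ Fin 2) × Bool)}
    {p q : ℝ} {h : Fin 2 → Bool} (hp0 : 0 ≤ p) (hp1 : p ≤ 1) (hq0 : 0 ≤ q) (hq1 : q ≤ 1)
    (hP : HasWeights P (mixtureWeight p q h)) {l u : ℕ} (hl : 1 ≤ l)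
    (ψ : (Fin l → (Fin 2 ⊕ Fin 2) × Bool) → (Fin u → Fin 2 ⊕ Fin 2) → Bool) :
    weightExpectedExcess (mixtureWeight p q h) (splitLearner ψ).toFun ≤
      (productMean (mixtureWeight p q h) l fun S =>
        productMean (marginalWeight (mixtureWeight p q h)) u fun T =>
          if ψ S T then max 0 (-(p - 1 / 2)) else max 0 (p - 1 / 2)) + 2 / l := by
  simp only [weightExpectedExcess, weightExcess_splitLearner hp0 hp1 hq0 hq1, productMean_add,
    productMean_const hP.sum_marginalWeight_eq_one, Fin.sum_univ_two, productMean_const_mul]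
  have hterm : ∀ j, pointMass q j / 2 * (productMean (mixtureWeight p q h) l fun S =>
      if decide (∃ i, S i = (Sum.inr j, true)) = h j then 0 else 1) ≤ 1 / l := by
    intro j
    have hw : mixtureWeight p q h (Sum.inr j, true) = if h j then pointMass q j / 2 else 0 := by
      cases hj : h j <;> simp [mixWeight, realizableWeight, hj]
    have hmiss := productMean_indicator_missing hP.sum_eq_one (Sum.inr j, true) l
    have hq := pointMass_nonneg hq0 hq1 j
    cases hj : h j
    · have hseen : ∀ S : Fin l → (Fin 2 ⊕ Fin 2) × Bool,
          (if decide (∃ i, S i = (Sum.inr j, true)) = false then (0 : ℝ) else 1) =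
            1 + -1 * if ∃ i, S i = (Sum.inr j, true) then 0 else 1 := fun S => by
        by_cases hS : ∃ i, S i = (Sum.inr j, true) <;> simp [hS]
      simp only [hseen, productMean_add, productMean_const_mul, hmiss,
        productMean_const hP.sum_eq_one, hw, hj]
      simp
    · simp only [decide_eq_true_eq, hmiss, hw, hj, if_true]
      exact mul_one_sub_pow_le (by positivity) (by linarith [pointMass_le_one hq0 hq1 j]) hl
  have h0 := hterm 0
  have h1 := hterm 1
  have : (2 : ℝ) / l = 1 / l + 1 / l := by ring
  linarith

/-- The difference of the indicators of the first two points. -/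
def massSign : Fin 2 ⊕ Fin 2 → ℝ
  | Sum.inl i => if i = 0 then 1 else -1
  | Sum.inr _ => 0

theorem abs_massSign_le_one (x : Fin 2 ⊕ Fin 2) : |massSign x| ≤ 1 := by
  rcases x with i | j
  · fin_cases i <;> simp [massSign]
  · simp [massSign]

theorem sum_marginalWeight_mul_massSign (p q : ℝ) (h : Fin 2 → Bool) :
    ∑ x, marginalWeight (mixtureWeight p q h) x * massSign x = p - 1 / 2 := by
  simp [massSign, marginalWeight, mixWeight, twoPointWeight, pointMass]
  ring

theorem sum_mixtureWeight_mul_massSign (p q : ℝ) (h : Fin 2 → Bool) :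
    ∑ z, mixtureWeight p q h z * massSign z.1 = p - 1 / 2 := by
  rw [← sum_marginalWeight_mul_massSign p q h, Fintype.sum_prod_type]
  simp [marginalWeight, add_mul]

/-- A wrong sign means that `T / n` and `m` lie on opposite sides of `0`, hence at least `|m|`
apart. -/
theorem sign_error_le {T m : ℝ} {n : ℕ} :
    (if decide (0 < T) then max 0 (-m) else max 0 m) ≤ |T / n - m| := by
  by_cases hT : 0 < T
  · have : 0 ≤ T / n := by positivity
    simp only [hT, decide_true, if_true]
    exact max_le (abs_nonneg _) ((by linarith : -m ≤ T / n - m).trans (le_abs_self _))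
  · have : T / n ≤ 0 := div_nonpos_of_nonpos_of_nonneg (not_lt.1 hT) (Nat.cast_nonneg n)
    simp only [hT, decide_false, Bool.false_eq_true, if_false]
    exact max_le (abs_nonneg _) ((by linarith : m ≤ -(T / n - m)).trans (neg_le_abs _))

theorem minimaxRisk_le_of_splitLearner {l u : ℕ}
    (ψ : (Fin l → (Fin 2 ⊕ Fin 2) × Bool) → (Fin u → Fin 2 ⊕ Fin 2) → Bool) {r : ℝ}
    (hr : ∀ (P : ProbabilityMeasure ((Fin 2 ⊕ Fin 2) × Bool)) (p q : ℝ) (h : Fin 2 → Bool),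
      HasWeights P (mixtureWeight p q h) →
      (productMean (mixtureWeight p q h) l fun S =>
        productMean (marginalWeight (mixtureWeight p q h)) u fun T =>
          if ψ S T then max 0 (-(p - 1 / 2)) else max 0 (p - 1 / 2)) ≤ r) (hl : 1 ≤ l) :
    twoPointMixture.minimaxRisk l u ≤ ENNReal.ofReal (r + 2 / l) := by
  refine iInf_le_of_le (splitLearner ψ) (iSup₂_le fun P hP => ?_)
  obtain ⟨p, q, h, hp0, hp1, hq0, hq1, hW⟩ := exists_hasWeights_of_mem_dist hP
  rw [twoPointMixture_hyp, hW.expectedExcessRisk_univ]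
  refine ENNReal.ofReal_le_ofReal
    ((weightExpectedExcess_splitLearner_le hp0.le hp1.le hq0 hq1 hW hl ψ).trans ?_)
  linarith [hr P p q h hW]

theorem supervised_upper_bound {l : ℕ} (hl : 1 ≤ l) :
    twoPointMixture.minimaxRisk l 0 ≤ ENNReal.ofReal (3 * (1 / Real.sqrt l)) := by
  have hl0 : (1 : ℝ) ≤ l := by exact_mod_cast hl
  refine (minimaxRisk_le_of_splitLearner (r := 1 / Real.sqrt l)
    (fun S _ => decide (0 < ∑ i, massSign (S i).1)) (fun P p q h hW => ?_) hl).trans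
    (ENNReal.ofReal_le_ofReal ?_)
  · simp only [productMean_const hW.sum_marginalWeight_eq_one]
    refine (productMean_mono hW.nonneg l fun S => sign_error_le (n := l)).trans ?_
    rw [← sum_mixtureWeight_mul_massSign p q h]
    exact productMean_abs_empirical_sub_le (g := fun z => massSign z.1) hW.nonneg hW.sum_eq_one
      (fun z => abs_massSign_le_one z.1) hl
  · have hs : Real.sqrt l ≤ l := Real.sqrt_le_iff.2 ⟨by linarith, by nlinarith⟩
    have := one_div_le_one_div_of_le (by positivity) hs
    have h2 : (2 : ℝ) / l = 2 * (1 / l) := by ring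
    linarith

theorem semisupervised_upper_bound {l u : ℕ} (hl : 1 ≤ l) (hu : l ^ 2 ≤ u) :
    twoPointMixture.minimaxRisk l u ≤ ENNReal.ofReal (3 * (1 / (l : ℝ))) := by
  have hl0 : (1 : ℝ) ≤ l := by exact_mod_cast hl
  have hu1 : 1 ≤ u := (Nat.one_le_pow _ _ hl).trans hu
  -- The sign is read off the unlabeled points only, and `√u ≥ l`.
  refine (minimaxRisk_le_of_splitLearner (r := 1 / Real.sqrt u)
    (fun _ T => decide (0 < ∑ i, massSign (T i))) (fun P p q h hW => ?_) hl).trans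
    (ENNReal.ofReal_le_ofReal ?_)
  · simp only [productMean_const hW.sum_eq_one]
    refine (productMean_mono hW.marginalWeight_nonneg u fun T => sign_error_le (n := u)).trans ?_
    rw [← sum_marginalWeight_mul_massSign p q h]
    exact productMean_abs_empirical_sub_le hW.marginalWeight_nonneg
      hW.sum_marginalWeight_eq_one abs_massSign_le_one hu1
  · have hs : (l : ℝ) ≤ Real.sqrt u := Real.le_sqrt_of_sq_le (by exact_mod_cast hu)
    have := one_div_le_one_div_of_le (by positivity) hs
    have h2 : (2 : ℝ) / l = 2 * (1 / l) := by ring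
    linarith

theorem hasFiniteVCDim_of_fintype {X : Type} [Fintype X] (H : Set (X → Bool)) :
    HasFiniteVCDim H :=
  ⟨Fintype.card X, fun s _ => s.card_le_univ⟩

end

end SSL

theorem mainTheorem1 :
    ∃ (XB : Type) (_ : MeasurableSpace XB) (_ : MeasurableSingletonClass XB)
      (HB : Set (XB → Bool)) (hHB : ∀ h ∈ HB, Measurable h)
      (Q : SSL.LearningProblem (Fin 2 ⊕ XB)),
      SSL.HasFiniteVCDim HB ∧
      Q = SSL.mixtureProblem SSL.twoPointProblem (SSL.realizableProblem HB hHB) ∧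
      SSL.HasFiniteVCDim Q.hyp ∧
      SSL.HasRate (fun l => Q.minimaxRisk l 0) (fun l => 1 / Real.sqrt l) ∧
      (∀ u : ℕ → ℕ, (∀ l, l ^ 2 ≤ u l) →
        SSL.HasRate (fun l => Q.minimaxRisk l (u l)) (fun l => 1 / (l : ℝ))) ∧
      (∃ c : ℝ, 0 < c ∧ ∀ u : ℕ → ℕ, ∀ l : ℕ, 1 ≤ l →
        ENNReal.ofReal (c * (1 / (l : ℝ))) ≤ Q.minimaxRisk l (u l)) := by
  refine ⟨Fin 2, inferInstance, inferInstance, Set.univ, fun _ _ => measurable_of_finite _,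
    SSL.twoPointMixture, SSL.hasFiniteVCDim_of_fintype _, rfl, SSL.hasFiniteVCDim_of_fintype _,
    ⟨1 / 256, 3, by norm_num, by norm_num, fun l hl =>
      ⟨SSL.supervised_lower_bound hl, SSL.supervised_upper_bound hl⟩⟩,
    fun u hu => ⟨1 / 32, 3, by norm_num, by norm_num, fun l hl =>
      ⟨SSL.semisupervised_lower_bound hl (u l), SSL.semisupervised_upper_bound hl (hu l)⟩⟩,
    ⟨1 / 32, by norm_num, fun u l hl => SSL.semisupervised_lower_bound hl (u l)⟩⟩
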